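/- Let $G$ be a finite group that is not soluble and whose soluble radical $R(G)$ (the largest soluble normal subgroup of $G$) is trivial. Let $\Gamma_{\rm S}(G)$ be the solubility graph of $G$, i.e. the simple graph whose vertices are the elements of $G\setminus R(G)$ and in which two distinct vertices $x,y$ are adjacent if and only if the subgroup $\langle x,y\rangle$ is soluble. Then the number of edges satisfies $$|E(\Gamma_{\rm S}(G))| > |G|+1.$$ -/

import Mathlib

/-- The soluble radical `R(G)` of a group `G`: the subgroup generated by all soluble normal
subgroups of `G`. For a finite group it is the largest soluble normal subgroup. -/
def solubleRadical (G : Type*) [Group G] : Subgroup G :=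
  sSup {N : Subgroup G | N.Normal ∧ Group.IsSolvable N}

/-- The solubility graph of a group `G`: its vertices are the elements of `G` outside the soluble
radical, and two distinct vertices are adjacent if and only if they generate a soluble
subgroup of `G`. -/
def solubilityGraph (G : Type*) [Group G] : SimpleGraph {x : G // x ∉ solubleRadical G} where
  Adj x y := x ≠ y ∧ Group.IsSolvable (Subgroup.closure ({(x : G), (y : G)} : Set G))
  symm := ⟨fun x y h => ⟨h.1.symm, by
    rw [Set.pair_comm]
    exact h.2⟩⟩
  loopless := ⟨fun _ h => h.1 rfl⟩

/-! Count ordered pairs generating a soluble subgroup. At most `3|G|` of them are degenerate and the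
others are darts, so `6|G|` soluble pairs yield at least `3|G|/2 > |G| + 1` edges. Each element
order `n` contributes at least `φ(n)|G|` pairs `(y, h)` with `y` of order `n` and `h` normalizing
`⟨y⟩`. The occurring orders give a totient sum of at least 6, unless every order is at most 3. There
orders 1 and 3 give `3|G|`, and pairs of involutions, which generate dihedral groups, give another
`3|G|` through `three_mul_card_le_sq_ncard_involutions`. Burnside's theorem makes this last case
empty, but the count does not need it. -/

/-! ### Soluble pairs from normalizers of cyclic subgroups -/

/-- If `h` normalizes the cyclic subgroup generated by `y`, then `y` and `h` generate a soluble
subgroup. -/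
theorem isSolvable_closure_pair_of_conj_mem_zpowers {G : Type*} [Group G] [Finite G] {y h : G}
    (hy : h * y * h⁻¹ ∈ Subgroup.zpowers y) :
    Group.IsSolvable (Subgroup.closure ({y, h} : Set G)) := by
  set H := Subgroup.closure ({y, h} : Set G) with hH
  set N := Subgroup.zpowers y with hN
  have hyH : y ∈ H := Subgroup.subset_closure (by simp)
  have hhH : h ∈ H := Subgroup.subset_closure (by simp)
  have hle : H ≤ Subgroup.normalizer (N : Set G) := by
    rw [hH, Subgroup.closure_le]
    rintro z (rfl | rfl)
    · exact Subgroup.le_normalizer (Subgroup.mem_zpowers _)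
    · have h1 : N.map (MulAut.conj z).toMonoidHom ≤ N := by
        rw [hN, MonoidHom.map_zpowers, Subgroup.zpowers_le]
        simpa using hy
      have h2 : N.map (MulAut.conj z).toMonoidHom = N :=
        Subgroup.eq_of_le_of_card_ge h1 (by
          rw [Subgroup.card_map_of_injective (MulAut.conj z).injective])
      rw [SetLike.mem_coe, Subgroup.mem_normalizer_iff]
      intro w
      constructor
      · intro hw
        exact h1 ⟨w, hw, by simp⟩
      · intro hw
        rw [← h2] at hw
        obtain ⟨v, hv, hvw⟩ := hw
        have : v = w := by simpa using hvw
        exact this ▸ hv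
  have : (N.subgroupOf H).Normal := Subgroup.normal_subgroupOf_of_le_normalizer hle
  rw [Group.isSolvable_iff_subgroup_quotient (N.subgroupOf H)]
  constructor
  · exact Group.isSolvable_of_comm (fun a b => by
      have ha : ((a : H) : G) ∈ N := a.2
      have hb : ((b : H) : G) ∈ N := b.2
      ext
      obtain ⟨i, hi⟩ := ha
      obtain ⟨j, hj⟩ := hb
      simp only at hi hj
      simp only [Subgroup.coe_mul, ← hi, ← hj, ← zpow_add, add_comm])
  · have key : ∀ q : H ⧸ N.subgroupOf H,
        q ∈ Subgroup.zpowers ((⟨h, hhH⟩ : H) : H ⧸ N.subgroupOf H) := by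
      intro q
      obtain ⟨⟨z, hz⟩, rfl⟩ := QuotientGroup.mk_surjective q
      induction hz using Subgroup.closure_induction with
      | mem z hz =>
        rcases hz with rfl | rfl
        · have : ((⟨z, hyH⟩ : H) : H ⧸ N.subgroupOf H) = 1 := by
            rw [QuotientGroup.eq_one_iff, Subgroup.mem_subgroupOf]
            exact Subgroup.mem_zpowers _
          rw [this]; exact one_mem _
        · exact Subgroup.mem_zpowers _
      | one => exact one_mem _
      | mul a b ha hb iha ihb => exact mul_mem iha ihb
      | inv a ha iha => exact inv_mem iha
    exact Group.isSolvable_of_comm (fun a b => by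
      obtain ⟨i, hi⟩ := key a
      obtain ⟨j, hj⟩ := key b
      simp only at hi hj
      simp only [← hi, ← hj, ← zpow_add, add_comm])

/-- The ordered pairs of elements of `G` that generate a soluble subgroup. -/
def solublePairs (G : Type*) [Group G] : Set (G × G) :=
  {p | Group.IsSolvable (Subgroup.closure ({p.1, p.2} : Set G))}

theorem totient_mul_card_le_ncard_solublePairs {G : Type*} [Group G] [Finite G] (x : G) :
    (orderOf x).totient * Nat.card G ≤
      (solublePairs G ∩ {p | orderOf p.1 = orderOf x}).ncard := by
  classical
  have := Fintype.ofFinite G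
  set n := orderOf x with hn
  let A : Finset (G × ℕ) := Finset.univ ×ˢ (Finset.range n).filter n.Coprime
  let f : G × ℕ → G := fun a => a.1 * x ^ a.2 * a.1⁻¹
  -- A section of `f` over its image `f(A)`; `(1, 0)` is a junk value elsewhere.
  have hsec : ∀ y : G, ∃ b : G × ℕ, (∃ a ∈ A, f a = y) → b ∈ A ∧ f b = y := by
    intro y
    by_cases h : ∃ a ∈ A, f a = y
    · obtain ⟨a, ha⟩ := h
      exact ⟨a, fun _ => ha⟩
    · exact ⟨(1, 0), fun h' => absurd h' h⟩
  choose sec hsec using hsec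
  have hcop : ∀ k, n.Coprime k → Subgroup.zpowers (x ^ k) = Subgroup.zpowers x := by
    intro k hk
    refine Subgroup.eq_of_le_of_card_ge ?_ ?_
    · rw [Subgroup.zpowers_le]; exact pow_mem (Subgroup.mem_zpowers x) k
    · rw [Nat.card_zpowers, Nat.card_zpowers, hk.orderOf_pow]
  have hA : A.card = n.totient * Nat.card G := by
    rw [Finset.card_product, Finset.card_univ, Nat.card_eq_fintype_card, mul_comm]
    rfl
  rw [← hA, ← Set.ncard_coe_finset]
  -- With `b = sec y` the chosen preimage of `y = f a`, both `a.1` and `b.1` conjugate `⟨x⟩` onto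
  -- `⟨y⟩`, so the quotient normalizes `⟨y⟩`. It determines `a.1` once `y` is known.
  refine Set.ncard_le_ncard_of_injOn (fun a => (f a, a.1 * (sec (f a)).1⁻¹)) ?_ ?_ (Set.toFinite _)
  · rintro ⟨g, k⟩ ha
    have hk : n.Coprime k := by
      have := ha; simp only [A, Finset.coe_product, Set.mem_prod, Finset.mem_coe,
        Finset.mem_filter] at this; exact this.2.2
    obtain ⟨hb, hfb⟩ := hsec (f (g, k)) ⟨(g, k), ha, rfl⟩
    set b := sec (f (g, k)) with hbdef
    constructor
    · refine isSolvable_closure_pair_of_conj_mem_zpowers ?_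
      have e1 : g * b.1⁻¹ * f (g, k) * (g * b.1⁻¹)⁻¹ = MulAut.conj g (x ^ b.2) := by
        rw [← hfb]; simp [f, mul_assoc]
      have e2 : f (g, k) = MulAut.conj g (x ^ k) := by simp [f]
      simp only
      rw [e1, e2]
      have : x ^ b.2 ∈ Subgroup.zpowers (x ^ k) := by
        rw [hcop k hk]; exact pow_mem (Subgroup.mem_zpowers x) _
      obtain ⟨i, hi⟩ := this
      refine ⟨i, ?_⟩
      simp only at hi ⊢
      rw [← map_zpow, hi]
    · have e2 : f (g, k) = MulAut.conj g (x ^ k) := by simp [f]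
      simp only [Set.mem_ofPred_eq]
      rw [e2, MulEquiv.orderOf_eq, hk.orderOf_pow]
  · rintro ⟨g, k⟩ ha ⟨g', k'⟩ ha' h
    have hk : k < n := by
      have := ha; simp only [A, Finset.coe_product, Set.mem_prod, Finset.mem_coe,
        Finset.mem_filter, Finset.mem_range] at this; exact this.2.1
    have hk' : k' < n := by
      have := ha'; simp only [A, Finset.coe_product, Set.mem_prod, Finset.mem_coe,
        Finset.mem_filter, Finset.mem_range] at this; exact this.2.1
    simp only [Prod.mk.injEq] at h
    obtain ⟨h1, h2⟩ := h
    rw [h1] at h2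
    have hg : g = g' := mul_right_cancel h2
    subst hg
    have : x ^ k = x ^ k' := by simpa [f] using h1
    rw [pow_injOn_Iio_orderOf hk hk' this]

theorem sum_totient_mul_card_le_ncard_solublePairs {G : Type*} [Group G] [Finite G]
    (D : Finset ℕ) (hD : ∀ n ∈ D, ∃ x : G, orderOf x = n) :
    (∑ n ∈ D, n.totient) * Nat.card G ≤
      (solublePairs G ∩ {p | orderOf p.1 ∈ D}).ncard := by
  classical
  induction D using Finset.induction_on with
  | empty => simp
  | insert n D hn ih =>
    rw [Finset.sum_insert hn, add_mul]
    obtain ⟨x, hx⟩ := hD n (by simp)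
    have h1 := totient_mul_card_le_ncard_solublePairs x
    rw [hx] at h1
    have h2 := ih (fun m hm => hD m (by simp [hm]))
    refine (add_le_add h1 h2).trans ?_
    rw [← Set.ncard_union_eq _ (Set.toFinite _) (Set.toFinite _)]
    · refine Set.ncard_le_ncard ?_ (Set.toFinite _)
      rintro p (⟨hp, hp'⟩ | ⟨hp, hp'⟩)
      · exact ⟨hp, by simp only [Set.mem_ofPred_eq] at hp' ⊢; simp [hp']⟩
      · exact ⟨hp, Finset.mem_insert_of_mem hp'⟩
    · rw [Set.disjoint_left]
      rintro p ⟨_, hp⟩ ⟨_, hp'⟩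
      simp only [Set.mem_ofPred_eq] at hp hp'
      exact hn (hp ▸ hp')

/-! ### Soluble pairs and edges -/

/-- Every soluble pair either is degenerate or comes from a dart of the solubility graph. -/
theorem ncard_solublePairs_le {G : Type*} [Group G] [Finite G] (hR : solubleRadical G = ⊥) :
    (solublePairs G).ncard ≤ 2 * Nat.card (solubilityGraph G).edgeSet + 3 * Nat.card G := by
  classical
  have := Fintype.ofFinite G
  have hdart := (solubilityGraph G).dart_card_eq_twice_card_edges
  have hedge : Nat.card (solubilityGraph G).edgeSet = (solubilityGraph G).edgeFinset.card := by
    rw [Nat.card_eq_fintype_card, SimpleGraph.edgeFinset_card]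
  rw [hedge, ← hdart]
  have hsub : solublePairs G ⊆
      Set.range (fun d : (solubilityGraph G).Dart => ((d.fst : G), (d.snd : G))) ∪
      (Set.range (fun y : G => ((1 : G), y)) ∪ (Set.range (fun y : G => (y, (1 : G))) ∪
        Set.range (fun y : G => (y, y)))) := by
    rintro ⟨x, y⟩ h
    by_cases hx : x = 1
    · right; left; exact ⟨y, by rw [hx]⟩
    by_cases hy : y = 1
    · right; right; left; exact ⟨x, by rw [hy]⟩
    by_cases hxy : x = y
    · right; right; right; exact ⟨x, by rw [hxy]⟩
    left
    refine ⟨⟨(⟨x, by rw [hR]; simpa using hx⟩, ⟨y, by rw [hR]; simpa using hy⟩),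
      ⟨fun he => hxy (congrArg Subtype.val he), h⟩⟩, rfl⟩
  have hrange : ∀ {α : Type _} [Fintype α] (f : α → G × G),
      (Set.range f).ncard ≤ Fintype.card α := by
    intro α _ f
    rw [← Set.image_univ, ← Nat.card_eq_fintype_card, ← Set.ncard_univ]
    exact Set.ncard_image_le
  have hrange' : ∀ f : G → G × G, (Set.range f).ncard ≤ Fintype.card G := fun f => hrange f
  refine (Set.ncard_le_ncard hsub (Set.toFinite _)).trans ?_
  refine (Set.ncard_union_le _ _).trans ?_
  refine add_le_add (hrange _) ?_
  refine (Set.ncard_union_le _ _).trans ?_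
  have h3 := Set.ncard_union_le (Set.range (fun y : G => (y, (1 : G))))
    (Set.range (fun y : G => (y, y)))
  have e1 := hrange' (fun y : G => ((1 : G), y))
  have e2 := hrange' (fun y : G => (y, (1 : G)))
  have e3 := hrange' (fun y : G => (y, y))
  rw [Nat.card_eq_fintype_card]
  omega

/-! ### Orders of elements and involutions -/

theorem two_lt_card_of_not_isSolvable {G : Type*} [Group G] [Finite G]
    (hG : ¬ Group.IsSolvable G) : 2 < Nat.card G := by
  by_contra! h
  have h0 : 0 < Nat.card G := Nat.card_pos
  apply hG
  interval_cases hc : Nat.card G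
  · have := (Nat.card_eq_one_iff_unique.1 hc).1
    infer_instance
  · have : Fact (Nat.Prime 2) := ⟨Nat.prime_two⟩
    have := isCyclic_of_prime_card hc
    exact Group.isSolvable_of_comm (fun a b => IsCyclic.commGroup.mul_comm a b)

theorem IsPGroup.isSolvable_of_finite {G : Type*} [Group G] [Finite G] {p : ℕ} (hp : p.Prime)
    (h : IsPGroup p G) : Group.IsSolvable G := by
  have : Fact p.Prime := ⟨hp⟩
  have := h.isNilpotent
  infer_instance

theorem exists_prime_orderOf_ne {G : Type*} [Group G] [Finite G] (hG : ¬ Group.IsSolvable G)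
    {p : ℕ} (hp : p.Prime) : ∃ r : ℕ, r.Prime ∧ r ≠ p ∧ ∃ x : G, orderOf x = r := by
  by_contra! h
  refine hG (IsPGroup.isSolvable_of_finite hp (IsPGroup.of_card
    (n := (Nat.card G).primeFactorsList.length) ?_))
  refine Nat.eq_prime_pow_of_unique_prime_dvd Nat.card_pos.ne' ?_
  intro d hd hdvd
  by_contra hne
  have : Fact d.Prime := ⟨hd⟩
  obtain ⟨x, hx⟩ := exists_prime_orderOf_dvd_card' (G := G) d hdvd
  exact h d hd hne x hx

theorem isSolvable_closure_pair_of_sq_eq_one {G : Type*} [Group G] [Finite G] {x y : G}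
    (hx : x ^ 2 = 1) (hy : y ^ 2 = 1) :
    Group.IsSolvable (Subgroup.closure ({x, y} : Set G)) := by
  have hx' : x⁻¹ = x := inv_eq_of_mul_eq_one_left (by rw [← sq, hx])
  have hy' : y⁻¹ = y := inv_eq_of_mul_eq_one_left (by rw [← sq, hy])
  -- The group is dihedral: `x` inverts `x * y`.
  have h := isSolvable_closure_pair_of_conj_mem_zpowers (y := x * y) (h := x)
    (by
      have : x * (x * y) * x⁻¹ = (x * y)⁻¹ := by
        rw [mul_inv_rev, hx', hy', ← mul_assoc, ← sq, hx, one_mul]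
      rw [this]
      exact inv_mem (Subgroup.mem_zpowers _))
  have hle : Subgroup.closure ({x, y} : Set G) ≤ Subgroup.closure {x * y, x} := by
    rw [Subgroup.closure_le]
    have h1 : x * y ∈ Subgroup.closure ({x * y, x} : Set G) := Subgroup.subset_closure (by simp)
    have h2 : x ∈ Subgroup.closure ({x * y, x} : Set G) := Subgroup.subset_closure (by simp)
    rintro z (rfl | rfl)
    · exact h2
    · simpa using mul_mem (inv_mem h2) h1
  exact Group.isSolvable_of_isSolvable_injective (Subgroup.inclusion_injective hle)

/-- The involutions of `G`. -/
def involutions (G : Type*) [Group G] : Set G := {x | x ^ 2 = 1 ∧ x ≠ 1}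

theorem conj_mem_involutions {G : Type*} [Group G] {t : G} (ht : t ∈ involutions G) (g : G) :
    g * t * g⁻¹ ∈ involutions G := by
  refine ⟨by rw [conj_pow, ht.1]; simp, fun h => ht.2 (by simpa using h)⟩

theorem card_le_ncard_involutions_mul {G : Type*} [Group G] [Finite G] {t : G}
    (ht : t ∈ involutions G) :
    Nat.card G ≤ (involutions G).ncard * Nat.card (Subgroup.centralizer {t}) := by
  rw [← Subgroup.index_mul_card (Subgroup.centralizer {t})]
  refine Nat.mul_le_mul_right _ ?_
  rw [Subgroup.index, ← Nat.card_coe_set_eq]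
  refine Nat.card_le_card_of_injective
    (fun c : G ⧸ Subgroup.centralizer {t} =>
      (⟨c.out * t * c.out⁻¹, conj_mem_involutions ht _⟩ : involutions G)) ?_
  intro c d h
  have h' : c.out * t * c.out⁻¹ = d.out * t * d.out⁻¹ := congrArg Subtype.val h
  rw [← QuotientGroup.out_eq' c, ← QuotientGroup.out_eq' d, QuotientGroup.eq,
    Subgroup.mem_centralizer_singleton_iff]
  have h2 := congrArg (fun z => d.out⁻¹ * z * c.out) h'
  have h3 : d.out⁻¹ * c.out * t = t * (d.out⁻¹ * c.out) := by
    simpa [mul_assoc] using h2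
  have h4 := congrArg (fun z => (d.out⁻¹ * c.out)⁻¹ * z * (d.out⁻¹ * c.out)⁻¹) h3
  have h5 : t * (c.out⁻¹ * d.out) = c.out⁻¹ * d.out * t := by
    simpa [mul_assoc] using h4
  exact h5.symm

/-! ### Groups with all element orders at most 3 -/

section SquareOrCube

variable {G : Type*} [Group G] (hG : ∀ x : G, x ^ 2 = 1 ∨ x ^ 3 = 1)
include hG

/-- If `c` had order 3, then `c * u` would have order 6. -/
theorem sq_eq_one_of_commute_involution {u c : G} (hu : u ∈ involutions G) (h : Commute c u) :
    c ^ 2 = 1 := by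
  rcases hG c with hc | hc
  · exact hc
  rcases hG (c * u) with h1 | h1
  · rwa [h.mul_pow, hu.1, mul_one] at h1
  · rw [h.mul_pow, hc, one_mul, pow_succ, hu.1, one_mul] at h1
    exact absurd h1 hu.2

theorem commute_of_commute_involution {u a b : G} (hu : u ∈ involutions G) (ha : Commute a u)
    (hb : Commute b u) : Commute a b := by
  have h1 := sq_eq_one_of_commute_involution hG hu ha
  have h2 := sq_eq_one_of_commute_involution hG hu hb
  have h3 := sq_eq_one_of_commute_involution hG hu (ha.mul_left hb)
  have i1 : a⁻¹ = a := inv_eq_of_mul_eq_one_left (by rw [← sq, h1])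
  have i2 : b⁻¹ = b := inv_eq_of_mul_eq_one_left (by rw [← sq, h2])
  have i3 : (a * b)⁻¹ = a * b := inv_eq_of_mul_eq_one_left (by rw [← sq, h3])
  rw [mul_inv_rev, i1, i2] at i3
  exact i3.symm

theorem commute_iff_commute_of_involutions {u s : G} (hu : u ∈ involutions G)
    (hs : s ∈ involutions G) (h : Commute s u) (z : G) : Commute z s ↔ Commute z u :=
  ⟨fun hz => commute_of_commute_involution hG hs hz h.symm,
   fun hz => commute_of_commute_involution hG hu hz h⟩

/-- Conjugating the nontrivial elements of `C(u)` by `C(t)` never repeats an involution: a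
coincidence yields an `r` commuting with both `t` and `u`, and `r ≠ 1` would force `t` and `u` to
commute. -/
theorem mul_pred_card_centralizer_le_ncard_involutions [Finite G] {u t : G}
    (hu : u ∈ involutions G) (ht : t ∈ involutions G) (htu : ¬ Commute t u) :
    Nat.card (Subgroup.centralizer {t}) * (Nat.card (Subgroup.centralizer {u}) - 1) ≤
      (involutions G).ncard := by
  have hmem : ∀ {w z : G}, z ∈ Subgroup.centralizer {w} ↔ Commute z w := by
    intro w z
    rw [Subgroup.mem_centralizer_singleton_iff]
    rfl
  have hcard : ((Subgroup.centralizer {u} : Set G) \ {1}).ncard =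
      Nat.card (Subgroup.centralizer {u}) - 1 := by
    rw [Set.ncard_sdiff_singleton_of_mem (one_mem (Subgroup.centralizer {u}))]
    rfl
  rw [← hcard, ← SetLike.coe_sort_coe (Subgroup.centralizer {t}), Nat.card_coe_set_eq,
    ← Set.ncard_prod]
  refine Set.ncard_le_ncard_of_injOn (fun p : G × G => p.1 * p.2 * p.1⁻¹) ?_ ?_ (Set.toFinite _)
  · rintro ⟨s, v⟩ ⟨-, hv, hv1⟩
    exact conj_mem_involutions ⟨sq_eq_one_of_commute_involution hG hu (hmem.1 hv), hv1⟩ _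
  · rintro ⟨s, v⟩ ⟨hs, hv, hv1⟩ ⟨s', v'⟩ ⟨hs', hv', hv1'⟩ h
    have hs := hmem.1 hs
    have hs' := hmem.1 hs'
    have hv := hmem.1 hv
    have hv' := hmem.1 hv'
    have hvI : v ∈ involutions G := ⟨sq_eq_one_of_commute_involution hG hu hv, hv1⟩
    have hvI' : v' ∈ involutions G := ⟨sq_eq_one_of_commute_involution hG hu hv', hv1'⟩
    simp only at h hs hs' hv hv'
    set r := s'⁻¹ * s with hr
    have hrt : Commute r t := hs'.inv_left.mul_left hs
    have hrv : r * v * r⁻¹ = v' := by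
      have := congrArg (fun z => s'⁻¹ * z * s') h
      simpa [hr, mul_assoc] using this
    have hru : Commute (r * u * r⁻¹) u := by
      have h1 : Commute (r * u * r⁻¹) (r * v * r⁻¹) := by
        have := hv.symm.map (MulAut.conj r)
        simpa using this
      rw [hrv] at h1
      exact (commute_iff_commute_of_involutions hG hu hvI' hv' _).1 h1
    have hrr : r⁻¹ = r := inv_eq_of_mul_eq_one_left (by
      rw [← sq]; exact sq_eq_one_of_commute_involution hG ht hrt)
    -- If `r * u` has cube 1, it is the inverse of its square, so it too commutes with `u`.
    have hsq : Commute ((r * u) ^ 2) u := by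
      have : (r * u) ^ 2 = r * u * r⁻¹ * u := by rw [hrr, sq, ← mul_assoc]
      rw [this]
      exact hru.mul_left (Commute.refl u)
    have hcru : Commute r u := by
      have hc : Commute (r * u) u := by
        rcases hG (r * u) with h2 | h3
        · have i1 : (r * u)⁻¹ = r * u := inv_eq_of_mul_eq_one_left (by rw [← sq, h2])
          have i2 : u⁻¹ = u := inv_eq_of_mul_eq_one_left (by rw [← sq, hu.1])
          rw [mul_inv_rev, hrr, i2] at i1
          have : Commute r u := i1.symm
          exact this.mul_left (Commute.refl u)
        · have : r * u = ((r * u) ^ 2)⁻¹ :=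
            eq_inv_of_mul_eq_one_left (by rw [← pow_succ', h3])
          rw [this]
          exact hsq.inv_left
      simpa using hc.mul_left (Commute.refl u).inv_left
    have hr1 : r = 1 := by
      by_contra hne
      have hrI : r ∈ involutions G := ⟨sq_eq_one_of_commute_involution hG ht hrt, hne⟩
      exact htu (commute_of_commute_involution hG hrI hrt.symm hcru.symm)
    have e1 : s = s' := by
      have : s'⁻¹ * s = 1 := hr1
      exact (inv_mul_eq_one.1 this).symm
    rw [hr1] at hrv
    have e2 : v = v' := by simpa using hrv
    rw [e1, e2]

theorem exists_involution_not_commute (hR : solubleRadical G = ⊥) {u : G}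
    (hu : u ∈ involutions G) : ∃ t ∈ involutions G, ¬ Commute t u := by
  by_contra! h
  have hmem : ∀ {z : G}, z ∈ Subgroup.centralizer {u} ↔ Commute z u := by
    intro z
    rw [Subgroup.mem_centralizer_singleton_iff]
    rfl
  -- Otherwise `C(u)` would be a nontrivial abelian normal subgroup.
  have hN : (Subgroup.centralizer {u}).Normal := by
    constructor
    intro n hn g
    rw [hmem] at hn ⊢
    by_cases hn1 : n = 1
    · simp [hn1]
    · exact h _ (conj_mem_involutions ⟨sq_eq_one_of_commute_involution hG hu hn, hn1⟩ g)
  have hS : Group.IsSolvable (Subgroup.centralizer {u}) :=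
    Group.isSolvable_of_comm (fun a b => Subtype.ext
      (commute_of_commute_involution hG hu (hmem.1 a.2) (hmem.1 b.2)))
  have hle : Subgroup.centralizer {u} ≤ solubleRadical G := le_sSup ⟨hN, hS⟩
  rw [hR] at hle
  exact hu.2 (Subgroup.mem_bot.1 (hle (hmem.2 (Commute.refl u))))

/-- A Sylow 3-subgroup is not normal, so its index `2 ^ k` is at least 4; a subgroup of that order
has exponent 2, hence is abelian and centralizes each of its involutions. -/
theorem exists_four_le_card_centralizer [Finite G] (hR : solubleRadical G = ⊥)
    {x : G} (hx : orderOf x = 3) :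
    ∃ u ∈ involutions G, 4 ≤ Nat.card (Subgroup.centralizer {u}) := by
  have : Fact (Nat.Prime 3) := ⟨Nat.prime_three⟩
  have : Fact (Nat.Prime 2) := ⟨Nat.prime_two⟩
  let P : Sylow 3 G := default
  have hP3 : ¬ 3 ∣ P.index := P.not_dvd_index
  obtain ⟨k, hk⟩ : ∃ k, P.index = 2 ^ k := by
    refine ⟨_, Nat.eq_prime_pow_of_unique_prime_dvd Subgroup.index_ne_zero_of_finite ?_⟩
    intro d hd hdvd
    have : Fact d.Prime := ⟨hd⟩
    obtain ⟨y, hy⟩ := exists_prime_orderOf_dvd_card' (G := G) d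
      (hdvd.trans (Subgroup.index_dvd_card _))
    rcases hG y with h | h
    · have := orderOf_dvd_of_pow_eq_one h
      rw [hy] at this
      exact (Nat.prime_dvd_prime_iff_eq hd Nat.prime_two).1 this
    · have := orderOf_dvd_of_pow_eq_one h
      rw [hy] at this
      rw [(Nat.prime_dvd_prime_iff_eq hd Nat.prime_three).1 this] at hdvd
      exact absurd hdvd hP3
  have hnn : ¬ (P : Subgroup G).Normal := by
    intro hN
    have hS : Group.IsSolvable (P : Subgroup G) :=
      IsPGroup.isSolvable_of_finite Nat.prime_three P.isPGroup'
    have hle : (P : Subgroup G) ≤ solubleRadical G := le_sSup ⟨hN, hS⟩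
    rw [hR, le_bot_iff] at hle
    rw [hle, Subgroup.index_bot, ← hx] at hP3
    exact hP3 (orderOf_dvd_natCard x)
  have hk2 : 2 ≤ k := by
    by_contra! hlt
    interval_cases k
    · rw [pow_zero, Subgroup.index_eq_one] at hk
      exact hnn (hk ▸ inferInstance)
    · exact hnn (Subgroup.normal_of_index_eq_two (by simpa using hk))
  obtain ⟨Q, hQ⟩ := Sylow.exists_subgroup_card_pow_prime (G := G) 2
    (n := k) (hk ▸ Subgroup.index_dvd_card _)
  have hQ4 : 4 ≤ Nat.card Q := by
    rw [hQ]
    calc 4 = 2 ^ 2 := rfl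
      _ ≤ 2 ^ k := Nat.pow_le_pow_right (by norm_num) hk2
  have hsq : ∀ z ∈ Q, z ^ 2 = 1 := by
    intro z hz
    rcases hG z with h | h
    · exact h
    have h1 : orderOf z ∣ 2 ^ k := by
      rw [← hQ]; exact Subgroup.orderOf_dvd_natCard _ hz
    have h2 := orderOf_dvd_of_pow_eq_one h
    have h3 : Nat.Coprime (2 ^ k) 3 := Nat.Coprime.pow_left _ (by norm_num)
    have h4 := Nat.eq_one_of_dvd_coprimes h3 h1 h2
    rw [orderOf_eq_one_iff] at h4
    simp [h4]
  have : Nontrivial Q := Finite.one_lt_card_iff_nontrivial.1 (by omega)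
  obtain ⟨⟨u, huQ⟩, hu1⟩ := exists_ne (1 : Q)
  have hu : u ∈ involutions G := ⟨hsq u huQ, fun h => hu1 (Subtype.ext h)⟩
  refine ⟨u, hu, hQ4.trans (Subgroup.card_le_of_le ?_)⟩
  intro z hz
  rw [Subgroup.mem_centralizer_singleton_iff]
  have i1 : z⁻¹ = z := inv_eq_of_mul_eq_one_left (by rw [← sq, hsq z hz])
  have i2 : u⁻¹ = u := inv_eq_of_mul_eq_one_left (by rw [← sq, hsq u huQ])
  have i3 : (z * u)⁻¹ = z * u :=
    inv_eq_of_mul_eq_one_left (by rw [← sq, hsq _ (mul_mem hz huQ)])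
  rw [mul_inv_rev, i1, i2] at i3
  exact i3.symm

theorem three_mul_card_le_sq_ncard_involutions [Finite G] (hR : solubleRadical G = ⊥)
    {x : G} (hx : orderOf x = 3) :
    3 * Nat.card G ≤ (involutions G).ncard * (involutions G).ncard := by
  obtain ⟨u, hu, hu4⟩ := exists_four_le_card_centralizer hG hR hx
  obtain ⟨t, ht, htu⟩ := exists_involution_not_commute hG hR hu
  have h1 := card_le_ncard_involutions_mul ht
  have h2 := mul_pred_card_centralizer_le_ncard_involutions hG hu ht htu
  have h3 : Nat.card (Subgroup.centralizer {t}) * 3 ≤ (involutions G).ncard :=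
    (Nat.mul_le_mul_left _ (by omega)).trans h2
  calc 3 * Nat.card G
      ≤ 3 * ((involutions G).ncard * Nat.card (Subgroup.centralizer {t})) :=
        Nat.mul_le_mul_left _ h1
    _ = (involutions G).ncard * (Nat.card (Subgroup.centralizer {t}) * 3) := by ring
    _ ≤ _ := Nat.mul_le_mul_left _ h3

end SquareOrCube

/-! ### Reaching `6|G|` by cases on element orders -/

theorem six_mul_card_le_of_sum_totient {G : Type*} [Group G] [Finite G] (D : Finset ℕ)
    (hD : ∀ n ∈ D, ∃ x : G, orderOf x = n) (h6 : 6 ≤ ∑ n ∈ D, n.totient) :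
    6 * Nat.card G ≤ (solublePairs G).ncard :=
  (Nat.mul_le_mul_right _ h6).trans ((sum_totient_mul_card_le_ncard_solublePairs D hD).trans
    (Set.ncard_le_ncard Set.inter_subset_left (Set.toFinite _)))

theorem six_mul_card_le_of_sq_or_cube {G : Type*} [Group G] [Finite G]
    (hR : solubleRadical G = ⊥) (hG : ∀ x : G, x ^ 2 = 1 ∨ x ^ 3 = 1) {x : G}
    (hx : orderOf x = 3) : 6 * Nat.card G ≤ (solublePairs G).ncard := by
  have h1 := three_mul_card_le_sq_ncard_involutions hG hR hx
  -- Order 2 is left out to keep these pairs disjoint from the pairs of involutions.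
  have h2 := sum_totient_mul_card_le_ncard_solublePairs (G := G) {1, 3} (by
    simp only [Finset.mem_insert, Finset.mem_singleton]
    rintro n (rfl | rfl)
    · exact ⟨1, orderOf_one⟩
    · exact ⟨x, hx⟩)
  have h3 : ∑ n ∈ ({1, 3} : Finset ℕ), n.totient = 3 := by decide
  rw [h3] at h2
  rw [← Set.ncard_prod] at h1
  have h4 : 6 * Nat.card G = 3 * Nat.card G + 3 * Nat.card G := by ring
  rw [h4]
  refine (add_le_add h1 h2).trans ?_
  rw [← Set.ncard_union_eq _ (Set.toFinite _) (Set.toFinite _)]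
  · refine Set.ncard_le_ncard ?_ (Set.toFinite _)
    rintro p (⟨ha, hb⟩ | ⟨hp, -⟩)
    · exact isSolvable_closure_pair_of_sq_eq_one ha.1 hb.1
    · exact hp
  · rw [Set.disjoint_left]
    rintro p ⟨ha, -⟩ ⟨-, hp⟩
    have ho : orderOf p.1 = 2 := orderOf_eq_prime ha.1 ha.2
    simp only [Set.mem_ofPred_eq, ho] at hp
    simp at hp

theorem six_mul_card_le_ncard_solublePairs {G : Type*} [Group G] [Finite G]
    (hG : ¬ Group.IsSolvable G) (hR : solubleRadical G = ⊥) :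
    6 * Nat.card G ≤ (solublePairs G).ncard := by
  have h1 : ∃ x : G, orderOf x = 1 := ⟨1, orderOf_one⟩
  by_cases h7 : ∃ p : ℕ, p.Prime ∧ 7 ≤ p ∧ ∃ x : G, orderOf x = p
  · obtain ⟨p, hp, hp7, hx⟩ := h7
    refine six_mul_card_le_of_sum_totient {p} (by simpa using hx) ?_
    rw [Finset.sum_singleton, Nat.totient_prime hp]
    omega
  push Not at h7
  have hsmall : ∀ p : ℕ, p.Prime → (∃ x : G, orderOf x = p) → p = 2 ∨ p = 3 ∨ p = 5 := by
    rintro p hp ⟨x, hx⟩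
    have hlt : p < 7 := by
      by_contra! h
      exact h7 p hp h x hx
    interval_cases p <;> first | omega | (exfalso; revert hp; decide)
  by_cases h5 : ∃ x : G, orderOf x = 5
  · obtain ⟨r, hr, hr5, hx⟩ := exists_prime_orderOf_ne hG Nat.prime_five
    refine six_mul_card_le_of_sum_totient {1, r, 5} ?_ ?_
    · simp only [Finset.mem_insert, Finset.mem_singleton]
      rintro n (rfl | rfl | rfl) <;> assumption
    · rcases hsmall r hr hx with rfl | rfl | rfl
      · decide
      · decide
      · exact absurd rfl hr5
  have h2 : ∃ x : G, orderOf x = 2 := by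
    obtain ⟨r, hr, hne, hx⟩ := exists_prime_orderOf_ne hG Nat.prime_three
    rcases hsmall r hr hx with rfl | rfl | rfl
    · exact hx
    · exact absurd rfl hne
    · exact absurd hx h5
  have h3 : ∃ x : G, orderOf x = 3 := by
    obtain ⟨r, hr, hne, hx⟩ := exists_prime_orderOf_ne hG Nat.prime_two
    rcases hsmall r hr hx with rfl | rfl | rfl
    · exact absurd rfl hne
    · exact hx
    · exact absurd hx h5
  by_cases hn : ∃ x : G, 3 < orderOf x
  · obtain ⟨x, hx⟩ := hn
    refine six_mul_card_le_of_sum_totient {orderOf x, 1, 2, 3} ?_ ?_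
    · simp only [Finset.mem_insert, Finset.mem_singleton]
      rintro n (rfl | rfl | rfl | rfl)
      · exact ⟨x, rfl⟩
      all_goals assumption
    · rw [Finset.sum_insert (by simp only [Finset.mem_insert, Finset.mem_singleton]; omega)]
      have e : ∑ n ∈ ({1, 2, 3} : Finset ℕ), n.totient = 4 := by decide
      -- The totient is even and positive, hence at least 2, and `4 + 2 = 6`.
      have he := Nat.totient_even (n := orderOf x) (by omega)
      have hpos := Nat.totient_pos.2 (orderOf_pos x)
      obtain ⟨m, hm⟩ := he
      omega
  push Not at hn
  obtain ⟨x, hx⟩ := h3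
  refine six_mul_card_le_of_sq_or_cube hR (fun y => ?_) hx
  have hy := hn y
  have hpos := orderOf_pos y
  have hpow := pow_orderOf_eq_one y
  interval_cases orderOf y
  · left; rw [pow_one] at hpow; simp [hpow]
  · exact Or.inl hpow
  · exact Or.inr hpow

theorem mainTheorem8 (G : Type*) [Group G] [Finite G] (hG : ¬ Group.IsSolvable G)
    (hR : solubleRadical G = ⊥) :
    Nat.card G + 1 < Nat.card (solubilityGraph G).edgeSet := by
  have h1 := six_mul_card_le_ncard_solublePairs hG hR
  have h2 := ncard_solublePairs_le hR
  have h3 := two_lt_card_of_not_isSolvable hG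
  omega
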